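/- Let $\hat f(z)=\sum_{p\ge 1} f_p z^p$ be a formal power series with complex coefficients (put $f_0=0$), let $r\in\mathbb N$ and $a_1,\dots,a_r\in\mathbb C$, and suppose that for every $j>r$ $$f_j=\sum_{k=1}^{r} a_k\, j(j-1)\cdots(j-k+1)\, f_{j-k},$$ or, equivalently, that for every $j>r$ $$\frac{f_j}{j!}=\sum_{k=1}^{r} a_k\,\frac{f_{j-k}}{(j-k)!}.$$ Then, for every $d\in\mathbb R$ which is not (modulo $2\pi$) an argument of a root of the polynomial $1-a_1z-\dots-a_rz^r$, the series $\hat f$ is $1$-summable in direction $d$. Here $\hat f$ is called $1$-summable in direction $d$ if there are $C,A>0$ with $|f_p|\le CA^p\,p!$ for all $p\ge 0$, and there exist $\alpha>1$, a sectorial region $G$ with bisecting direction $d$ and opening $\alpha\pi$, and a holomorphic function $f$ on $G$ which admits $\hat f$ as its Gevrey asymptotic expansion of order $1$. That is, for every sector $T$ of finite radius whose closure, with the vertex $0$ removed, is contained in $G$, there are $C,A>0$ such that for all $N\ge 0$ and $z\in T$ $$\Bigl|f(z)-\sum_{p=0}^{N-1}f_pz^p\Bigr|\le C A^N N!\,|z|^N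 .$$ Sectors are taken on the Riemann surface $\mathcal R$ of the logarithm. A sectorial region with bisecting direction $d$ and opening $\alpha\pi$ is a domain $G\subset\{z\in\mathcal R: |\arg z-d|<\alpha\pi/2\}$ which contains, for every $\beta\in(0,\alpha)$, a sector $\{z\in\mathcal R: |\arg z-d|<\beta\pi/2,\ 0<|z|<\rho\}$ with some $\rho=\rho(\beta)>0$. -/

import Mathlib

open scoped Nat Polynomial

namespace GevreySummability

/-- The Riemann surface of the logarithm. The logarithm is a global biholomorphic chart onto `ℂ`,
so a point of the surface is given by its logarithm `w`; its modulus is `exp (re w)`, its argument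
is `im w`, and a function is holomorphic on the surface iff it is holomorphic in `w`. -/
abbrev LogSurface : Type := ℂ

/-- The projection of the Riemann surface of the logarithm onto `ℂ ∖ {0}`: the complex number `z`
underlying a point. -/
noncomputable def LogSurface.toComplex (w : LogSurface) : ℂ := Complex.exp w

/-- The modulus `|z| > 0` of a point. -/
noncomputable def LogSurface.modulus (w : LogSurface) : ℝ := Real.exp (Complex.re w)

/-- The argument of a point, a real number (not taken modulo `2π`). -/
def LogSurface.argument (w : LogSurface) : ℝ := Complex.im w

/-- The unbounded sector `S_d(θ) = {z : |arg z - d| < θπ/2}`. -/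
def unboundedSector (d θ : ℝ) : Set LogSurface :=
  {w | |LogSurface.argument w - d| < Real.pi * θ / 2}

/-- The bounded sector `S_d(θ, ρ) = {z : |arg z - d| < θπ/2, 0 < |z| < ρ}`. -/
def boundedSector (d θ ρ : ℝ) : Set LogSurface :=
  {w | |LogSurface.argument w - d| < Real.pi * θ / 2 ∧ LogSurface.modulus w < ρ}

/-- `G` is a sectorial region with bisecting direction `d` and opening `απ`: a domain contained in
`S_d(α)` which contains, for every `β ∈ (0, α)`, a bounded sector `S_d(β, ρ)` with `ρ > 0`. -/
structure IsSectorialRegion (d α : ℝ) (G : Set LogSurface) : Prop where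
  isOpen : IsOpen G
  isConnected : IsConnected G
  subset_sector : G ⊆ unboundedSector d α
  sector_subset : ∀ β : ℝ, 0 < β → β < α → ∃ ρ : ℝ, 0 < ρ ∧ boundedSector d β ρ ⊆ G

/-- `T ≺ G`: `T` is a sector of finite radius whose closure (the vertex, which is not a point of
the surface, being left out) is contained in `G`. -/
def IsProperSubsector (T G : Set LogSurface) : Prop :=
  (∃ d β ρ : ℝ, 0 < β ∧ 0 < ρ ∧ T = boundedSector d β ρ) ∧ closure T ⊆ G

/-- `f` is holomorphic in `G` and admits the formal power series `F` as its Gevrey asymptotic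
expansion of order `s` in `G`: for every `T ≺ G` there are `C, A > 0` with
`|f(z) - ∑_{p < N} F_p z^p| ≤ C A^N (N!)^s |z|^N` for all `z ∈ T` and all `N`. -/
def HasGevreyExpansion (s : ℝ) (G : Set LogSurface) (f : LogSurface → ℂ) (F : PowerSeries ℂ) :
    Prop :=
  DifferentiableOn ℂ f G ∧
    ∀ T : Set LogSurface, IsProperSubsector T G →
      ∃ C A : ℝ, 0 < C ∧ 0 < A ∧ ∀ N : ℕ, ∀ w ∈ T,
        ‖f w - ∑ p ∈ Finset.range N, PowerSeries.coeff p F * LogSurface.toComplex w ^ p‖ ≤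
          C * A ^ N * (N ! : ℝ) ^ s * LogSurface.modulus w ^ N

/-- The formal power series `F` is of Gevrey order `s`: `|F_p| ≤ C A^p (p!)^s`. -/
def IsOfGevreyOrder (s : ℝ) (F : PowerSeries ℂ) : Prop :=
  ∃ C A : ℝ, 0 < C ∧ 0 < A ∧ ∀ p : ℕ, ‖PowerSeries.coeff p F‖ ≤ C * A ^ p * (p ! : ℝ) ^ s

/-- `F` is `k`-summable in direction `d`: it is of Gevrey order `1/k`, and it is the Gevrey
asymptotic expansion of order `1/k` of a holomorphic function on some sectorial region bisected by
`d` with opening larger than `π/k`. -/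
def IsSummableInDirection (k : ℝ) (F : PowerSeries ℂ) (d : ℝ) : Prop :=
  IsOfGevreyOrder (1 / k) F ∧
    ∃ α : ℝ, 1 / k < α ∧ ∃ G : Set LogSurface, IsSectorialRegion d α G ∧
      ∃ f : LogSurface → ℂ, HasGevreyExpansion (1 / k) G f F

end GevreySummability

/-! Dividing by `p!` gives the recurrence constant coefficients, so the Borel transform `B(t) = ∑
f_p t^p / p!` is rational with denominator `1 - a₁t - ⋯ - a_r t^r` (`recSum`). In a direction
without roots the denominator stays away from zero on a thin sector (`exists_sector_le_norm_eval`),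
and the Laplace integral `∫ B(t) e^{-t/z} dt/z` sums the series.

The ray turns slowly with `z`: put `t = u z σ` with `σ = (z e^{-id})^{-(1-η)}`. Then `arg t = d + η
(arg z - d)` stays in the thin sector, while `re σ > 0` for `|arg z - d| < (1+η)π/2`. As `σ` is
holomorphic in `log z`, one formula covers an opening larger than `π`, and no rotated integrals have
to be glued (`differentiableOn_laplace`).

The tails `B_N` of the Borel series share the denominator, satisfy `B_N = b_N + t B_{N+1}` and are
`O(A^N e^{|t|})` on the rays. Peeling off terms leaves the remainder `∫ t^N B_N(t) e^{-t/z} dt/z`,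
which gives the Gevrey bound (`norm_laplace_sub_sum_le`). -/

namespace GevreySummability

/-! ### The rational Borel transform and its tails -/

section FormalPart

open Finset

/-- The denominator `1 - a₁ t - ⋯ - a_r t^r`. -/
noncomputable def charDenom (a : ℕ → ℂ) (r : ℕ) (t : ℂ) : ℂ :=
  1 - ∑ k ∈ range r, a (k + 1) * t ^ (k + 1)

/-- The `j`-th coefficient of the product of `1 - a₁ t - a₂ t² - ⋯` and `∑ b_p t^p`. -/
noncomputable def numerCoeff (a b : ℕ → ℂ) (j : ℕ) : ℂ :=
  b j - ∑ k ∈ range j, a (k + 1) * b (j - (k + 1))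

/-- The sum of the power series `∑ b_p t^p`, as a rational function, for a sequence `b` with
`b_j = a₁ b_{j-1} + ⋯ + a_r b_{j-r}` when `j > r`. -/
noncomputable def recSum (a : ℕ → ℂ) (r : ℕ) (b : ℕ → ℂ) (t : ℂ) : ℂ :=
  (∑ j ∈ range (r + 1), numerCoeff a b j * t ^ j) / charDenom a r t

theorem sum_Icc_one_eq_sum_range (r : ℕ) (g : ℕ → ℂ) :
    ∑ k ∈ Icc 1 r, g k = ∑ k ∈ range r, g (k + 1) := by
  rw [range_eq_Ico, sum_Ico_add' g 0 r 1]
  rfl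

/-- After clearing the common denominator this compares numerators. The only obstruction is the
degree `r + 1` term of `t` times the shifted numerator, and the recurrence at `r + 1` kills it. -/
theorem recSum_eq_add_mul {a : ℕ → ℂ} {r : ℕ} {b : ℕ → ℂ}
    (hb : b (r + 1) = ∑ k ∈ range r, a (k + 1) * b (r + 1 - (k + 1))) {t : ℂ}
    (ht : charDenom a r t ≠ 0) :
    recSum a r b t = b 0 + t * recSum a r (fun p => b (p + 1)) t := by
  have h1 : ∀ j, numerCoeff a (fun p => b (p + 1)) j =
      b (j + 1) - ∑ k ∈ range j, a (k + 1) * b (j + 1 - (k + 1)) := by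
    intro j
    unfold numerCoeff
    congr 1
    refine sum_congr rfl fun k hk => ?_
    rw [show j + 1 - (k + 1) = j - (k + 1) + 1 by have := mem_range.1 hk; omega]
  have h2 : ∀ j, numerCoeff a b (j + 1) =
      numerCoeff a (fun p => b (p + 1)) j - a (j + 1) * b 0 := by
    intro j
    rw [h1, numerCoeff, sum_range_succ]
    simp only [Nat.sub_self]
    ring
  have h3 : numerCoeff a (fun p => b (p + 1)) r = 0 := by rw [h1, hb, sub_self]
  have h0 : numerCoeff a b 0 = b 0 := by simp [numerCoeff]
  unfold recSum
  rw [div_eq_iff ht, add_mul, mul_div_assoc', div_mul_cancel₀ _ ht, sum_range_succ', h0,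
    sum_range_succ _ r, h3, charDenom]
  simp only [h2, sub_mul, sum_sub_distrib, mul_sub, mul_sum, zero_mul, add_zero, pow_zero, mul_one]
  have e1 : ∀ k, a (k + 1) * b 0 * t ^ (k + 1) = b 0 * (a (k + 1) * t ^ (k + 1)) :=
    fun k => by ring
  have e2 : ∀ k, numerCoeff a (fun p => b (p + 1)) k * t ^ (k + 1) =
    t * (numerCoeff a (fun p => b (p + 1)) k * t ^ k) := fun k => by ring
  simp only [e1, e2]
  ring

theorem exists_norm_le_geometric {a b : ℕ → ℂ} {r : ℕ}
    (hb : ∀ j, r < j → b j = ∑ k ∈ range r, a (k + 1) * b (j - (k + 1))) :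
    ∃ C A : ℝ, 0 < C ∧ 1 ≤ A ∧ ∀ p, ‖b p‖ ≤ C * A ^ p := by
  set S := ∑ k ∈ range r, ‖a (k + 1)‖ with hS
  have hS0 : 0 ≤ S := sum_nonneg fun _ _ => norm_nonneg _
  set C := 1 + ∑ i ∈ range (r + 1), ‖b i‖ with hC
  have hC0 : 0 < C := by positivity
  have hA : 1 ≤ 1 + S := by linarith
  -- `C` absorbs the initial values up to index `r`; each use of the recurrence costs at most a
  -- factor `S ≤ 1 + S`.
  refine ⟨C, 1 + S, hC0, hA, fun p => ?_⟩
  induction p using Nat.strong_induction_on with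
  | _ p ih =>
  rcases le_or_gt p r with hp | hp
  · have h1 : ‖b p‖ ≤ ∑ i ∈ range (r + 1), ‖b i‖ :=
      single_le_sum (f := fun i => ‖b i‖) (fun _ _ => norm_nonneg _)
        (mem_range.2 (Nat.lt_succ_of_le hp))
    calc ‖b p‖ ≤ C * 1 := by linarith
      _ ≤ C * (1 + S) ^ p := by gcongr; exact one_le_pow₀ hA
  · obtain ⟨q, rfl⟩ : ∃ q, p = q + 1 := ⟨p - 1, by omega⟩
    rw [hb _ hp]
    calc ‖∑ k ∈ range r, a (k + 1) * b (q + 1 - (k + 1))‖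
        ≤ ∑ k ∈ range r, ‖a (k + 1)‖ * (C * (1 + S) ^ q) := by
          refine norm_sum_le_of_le _ fun k hk => ?_
          rw [norm_mul]
          gcongr
          refine (ih _ (by omega)).trans ?_
          gcongr
          omega
      _ = S * (C * (1 + S) ^ q) := by rw [← sum_mul]
      _ ≤ (1 + S) * (C * (1 + S) ^ q) := by gcongr; linarith
      _ = C * (1 + S) ^ (q + 1) := by ring

/-- A shift by `N` costs each numerator coefficient a factor `A ^ N`, and `|t|^j ≤ j! e^{|t|}`
handles the powers of `t`; hence `K` is independent of `N`. -/
theorem exists_norm_recSum_shift_le {a b : ℕ → ℂ} {r : ℕ} {C A q : ℝ} (hC : 0 < C) (hA : 1 ≤ A)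
    (hb : ∀ p, ‖b p‖ ≤ C * A ^ p) (hq : 0 < q) :
    ∃ K : ℝ, 0 < K ∧ ∀ (N : ℕ) (t : ℂ), q ≤ ‖charDenom a r t‖ →
      ‖recSum a r (fun p => b (N + p)) t‖ ≤ K * A ^ N * Real.exp ‖t‖ := by
  set S : ℕ → ℝ := fun j => C * A ^ j + ∑ k ∈ range j, ‖a (k + 1)‖ * (C * A ^ (j - (k + 1)))
    with hS
  have hS0 : ∀ j, 0 < S j := fun j => by positivity
  have hcoef : ∀ N j, ‖numerCoeff a (fun p => b (N + p)) j‖ ≤ S j * A ^ N := by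
    intro N j
    have hb' : ∀ i, ‖b (N + i)‖ ≤ C * A ^ i * A ^ N := fun i =>
      (hb _).trans_eq (by ring)
    refine (norm_sub_le _ _).trans ?_
    rw [hS, add_mul, sum_mul]
    refine add_le_add (hb' j) (norm_sum_le_of_le _ fun k _ => ?_)
    rw [norm_mul, mul_assoc]
    gcongr
    exact hb' _
  refine ⟨(∑ j ∈ range (r + 1), S j * j !) / q, ?_, fun N t ht => ?_⟩
  · refine div_pos (sum_pos (fun j _ => mul_pos (hS0 j) (by positivity)) (by simp)) hq
  · rw [recSum, norm_div, div_le_iff₀ (hq.trans_le ht)]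
    calc ‖∑ j ∈ range (r + 1), numerCoeff a (fun p => b (N + p)) j * t ^ j‖
        ≤ ∑ j ∈ range (r + 1), S j * A ^ N * (j ! * Real.exp ‖t‖) := by
          refine norm_sum_le_of_le _ fun j _ => ?_
          rw [norm_mul, norm_pow]
          have h1 := Real.pow_div_factorial_le_exp ‖t‖ (norm_nonneg t) j
          rw [div_le_iff₀ (by positivity)] at h1
          have h2 := hS0 j
          gcongr
          · exact hcoef N j
          · linarith
      _ = (∑ j ∈ range (r + 1), S j * j !) / q * A ^ N * Real.exp ‖t‖ * q := by
          simp only [div_mul_eq_mul_div]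
          rw [mul_div_cancel_right₀ _ hq.ne', sum_mul, sum_mul]
          exact sum_congr rfl fun j _ => by ring
      _ ≤ _ := by
          have : 0 ≤ ∑ j ∈ range (r + 1), S j * (j ! : ℝ) :=
            sum_nonneg fun j _ => mul_nonneg (hS0 j).le (by positivity)
          gcongr

/-! ### Lower bounds for the denominator near the direction `d` -/

theorem eval_charPoly (a : ℕ → ℂ) (r : ℕ) (t : ℂ) :
    (1 - ∑ k ∈ Icc 1 r, Polynomial.C (a k) * Polynomial.X ^ k : ℂ[X]).eval t =
      charDenom a r t := by
  rw [charDenom, ← sum_Icc_one_eq_sum_range r fun k => a k * t ^ k]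
  simp [Polynomial.eval_finsetSum]

theorem exists_le_norm_eval_of_large (P : ℂ[X]) (h0 : P.eval 0 = 1) :
    ∃ R : ℝ, ∀ t : ℂ, R ≤ ‖t‖ → 1 ≤ ‖P.eval t‖ := by
  rcases le_or_gt P.degree 0 with hd | hd
  · refine ⟨0, fun t _ => ?_⟩
    rw [Polynomial.eq_C_of_degree_le_zero hd] at h0 ⊢
    simp only [Polynomial.eval_C] at h0 ⊢
    simp [h0]
  · have h := P.tendsto_norm_atTop hd (tendsto_norm_cocompact_atTop (E := ℂ))
    have h1 := h.eventually_ge_atTop 1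
    rw [← Metric.cobounded_eq_cocompact, ← comap_norm_atTop, Filter.eventually_comap, Filter.eventually_atTop] at h1
    obtain ⟨R, hR⟩ := h1
    exact ⟨R, fun t ht => hR _ ht t rfl⟩

/-- A polynomial with value `1` at `0` and no root in direction `d` is bounded away from zero on a
thin sector around that direction. -/
theorem exists_sector_le_norm_eval (P : ℂ[X]) (h0 : P.eval 0 = 1) (d : ℝ)
    (hd : ∀ ζ : ℂ, P.IsRoot ζ → (Complex.arg ζ : Real.Angle) ≠ (d : Real.Angle)) :
    ∃ ε q : ℝ, 0 < ε ∧ 0 < q ∧ ∀ u θ : ℝ, 0 ≤ u → |θ - d| ≤ ε →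
      q ≤ ‖P.eval (u * Complex.exp (θ * Complex.I))‖ := by
  obtain ⟨R, hR⟩ := exists_le_norm_eval_of_large P h0
  let g : ℝ × ℝ → ℝ := fun x => ‖P.eval (x.1 * Complex.exp (x.2 * Complex.I))‖
  have hg : Continuous g := by
    have := P.continuous
    fun_prop
  have hray : ∀ u : ℝ, 0 ≤ u → 0 < g (u, d) := by
    intro u hu
    refine norm_pos_iff.2 fun hz => ?_
    rcases hu.eq_or_lt with rfl | hu
    · simp [h0] at hz
    · refine hd _ hz ?_
      have := Complex.arg_mul_cos_add_sin_mul_I_coe_angle hu (d : Real.Angle)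
      rwa [Real.Angle.cos_coe, Real.Angle.sin_coe, Complex.ofReal_cos, Complex.ofReal_sin,
        ← Complex.exp_mul_I] at this
  -- Positivity on the compact segment `[0, R]` of the ray spreads to nearby angles; beyond `R` the
  -- angle is irrelevant.
  obtain ⟨U, V, -, hV, hU, hdV, hUV⟩ := generalized_tube_lemma
    (isCompact_Icc (a := (0 : ℝ)) (b := R)) (isCompact_singleton (x := d))
    (isOpen_Ioi.preimage hg : IsOpen (g ⁻¹' Set.Ioi 0)) (by
      rintro ⟨u, θ⟩ ⟨hu, hθ⟩
      obtain rfl : θ = d := hθ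
      exact hray u hu.1)
  obtain ⟨ε, hε, hεV⟩ := Metric.nhds_basis_closedBall.mem_iff.1
    (hV.mem_nhds (hdV (Set.mem_singleton d)))
  have hK : IsCompact (Set.Icc 0 R ×ˢ Metric.closedBall d ε) :=
    isCompact_Icc.prod (isCompact_closedBall d ε)
  obtain ⟨q, hq, hqle⟩ := hK.exists_forall_le' (f := g) hg.continuousOn (a := 0)
    fun x hx => hUV ⟨hU hx.1, hεV hx.2⟩
  refine ⟨ε, min q 1, hε, lt_min hq one_pos, fun u θ hu hθ => ?_⟩
  rcases le_or_gt u R with huR | huR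
  · exact (min_le_left _ _).trans (hqle (u, θ) ⟨⟨hu, huR⟩, by
      rwa [Metric.mem_closedBall, Real.dist_eq]⟩)
  · refine (min_le_right _ _).trans (hR _ ?_)
    rw [norm_mul, Complex.norm_exp_ofReal_mul_I, mul_one, Complex.norm_real, Real.norm_eq_abs,
      abs_of_nonneg hu]
    exact huR.le

theorem recurrence_iff_borel (f a : ℕ → ℂ) (r j : ℕ) (hj : r < j) :
    (f j = ∑ k ∈ Icc 1 r, a k * (j.descFactorial k : ℂ) * f (j - k)) ↔
      f j / (j ! : ℂ) = ∑ k ∈ Icc 1 r, a k * (f (j - k) / ((j - k)! : ℂ)) := by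
  rw [div_eq_iff (by exact_mod_cast j.factorial_ne_zero), sum_mul]
  have : ∀ k ∈ Icc 1 r, a k * (j.descFactorial k : ℂ) * f (j - k) =
      a k * (f (j - k) / ((j - k)! : ℂ)) * (j ! : ℂ) := by
    intro k hk
    have hk' : k ≤ j := (mem_Icc.1 hk).2.trans hj.le
    rw [← Nat.factorial_mul_descFactorial hk']
    have : ((j - k)! : ℂ) ≠ 0 := by exact_mod_cast (j - k).factorial_ne_zero
    push_cast
    field_simp
  rw [sum_congr rfl this]

end FormalPart

open MeasureTheory Set Filter Topology

/-! ### Laplace integrals of monomials -/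

theorem integrableOn_pow_mul_exp_neg_mul {κ : ℝ} (hκ : 0 < κ) (n : ℕ) :
    IntegrableOn (fun u : ℝ => u ^ n * Real.exp (-(κ * u))) (Ioi 0) := by
  have h := integrableOn_rpow_mul_exp_neg_mul_rpow (s := n) (p := 1) (b := κ)
    (by have : (0 : ℝ) ≤ n := n.cast_nonneg
        linarith) one_pos hκ
  simpa using h

theorem integral_pow_mul_exp_neg_mul {κ : ℝ} (hκ : 0 < κ) (n : ℕ) :
    ∫ u in Ioi (0 : ℝ), u ^ n * Real.exp (-(κ * u)) = n ! / κ ^ (n + 1) := by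
  have h := Real.integral_rpow_mul_exp_neg_mul_Ioi (a := n + 1) (r := κ) (by positivity) hκ
  have e : (1 / κ) ^ ((n : ℝ) + 1) = 1 / κ ^ (n + 1) := by
    rw [← Nat.cast_succ, Real.rpow_natCast, one_div_pow]
  rw [e, Real.Gamma_nat_eq_factorial] at h
  simp only [add_sub_cancel_right, Real.rpow_natCast] at h
  rw [h]
  ring

theorem integrableOn_pow_mul_cexp_neg_mul {σ : ℂ} (hσ : 0 < σ.re) (n : ℕ) :
    IntegrableOn (fun u : ℝ => (u : ℂ) ^ n * Complex.exp (-(u * σ))) (Ioi 0) := by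
  refine Integrable.mono' (integrableOn_pow_mul_exp_neg_mul hσ n)
    (Continuous.aestronglyMeasurable (by fun_prop)) ?_
  filter_upwards [ae_restrict_mem measurableSet_Ioi] with u hu
  rw [norm_mul, norm_pow, Complex.norm_real, Complex.norm_exp, Real.norm_eq_abs, abs_of_pos hu]
  simp [mul_comm]

theorem integral_pow_mul_cexp_neg_mul {σ : ℂ} (hσ : 0 < σ.re) (n : ℕ) :
    ∫ u in Ioi (0 : ℝ), (u : ℂ) ^ n * Complex.exp (-(u * σ)) = n ! / σ ^ (n + 1) := by
  have hσ0 : σ ≠ 0 := by rintro rfl; simp at hσ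
  induction n with
  | zero =>
    have h := integral_exp_mul_complex_Ioi (a := -σ) (by simpa) 0
    simp only [Complex.ofReal_zero, mul_zero, Complex.exp_zero, neg_div_neg_eq] at h
    simpa [mul_comm] using h
  | succ n ih =>
    -- Integration by parts: the boundary terms of `u^(n+1) e^{-uσ}` vanish at `0` and at infinity.
    have hd : ∀ u ∈ Ici (0 : ℝ),
        HasDerivAt (fun u : ℝ => (u : ℂ) ^ (n + 1) * Complex.exp (-(u * σ)))
        ((n + 1 : ℂ) * ((u : ℂ) ^ n * Complex.exp (-(u * σ))) -
          σ * ((u : ℂ) ^ (n + 1) * Complex.exp (-(u * σ)))) u := by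
      intro u _
      have h1 : HasDerivAt (fun x : ℂ => x ^ (n + 1) * Complex.exp (-(x * σ)))
          (((n + 1 : ℕ) : ℂ) * (u : ℂ) ^ n * Complex.exp (-(u * σ)) +
            (u : ℂ) ^ (n + 1) * (Complex.exp (-(u * σ)) * (-(1 * σ)))) (u : ℂ) := by
        have h2 := (((hasDerivAt_id (u : ℂ)).mul_const σ).neg).cexp
        have h3 := hasDerivAt_pow (n + 1) (u : ℂ)
        have h4 := h3.mul h2
        simp only [id] at h4 ⊢
        exact h4.congr_deriv (by simp)
      refine h1.comp_ofReal.congr_deriv ?_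
      push_cast
      ring
    have hlim : Tendsto (fun u : ℝ => (u : ℂ) ^ (n + 1) * Complex.exp (-(u * σ))) atTop (𝓝 0) := by
      rw [tendsto_zero_iff_norm_tendsto_zero]
      have h1 := Real.tendsto_pow_mul_exp_neg_atTop_nhds_zero (n + 1)
      have h2 := (h1.comp (tendsto_id.const_mul_atTop hσ)).const_mul (σ.re ^ (n + 1))⁻¹
      rw [mul_zero] at h2
      refine h2.congr' ?_
      filter_upwards [eventually_ge_atTop 0] with u hu
      rw [norm_mul, norm_pow, Complex.norm_real, Complex.norm_exp, Real.norm_eq_abs,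
        abs_of_nonneg hu]
      simp only [Function.comp, id, mul_pow, Complex.neg_re, Complex.re_ofReal_mul]
      rw [mul_comm u σ.re]
      field_simp
    have i1 := (integrableOn_pow_mul_cexp_neg_mul hσ n).const_mul (n + 1 : ℂ)
    have i2 := (integrableOn_pow_mul_cexp_neg_mul hσ (n + 1)).const_mul σ
    have h := integral_Ioi_of_hasDerivAt_of_tendsto' hd (i1.sub i2) hlim
    rw [integral_sub i1 i2, integral_const_mul, integral_const_mul, ih] at h
    simp only [Complex.ofReal_zero, ne_eq, Nat.add_eq_zero_iff, one_ne_zero, and_false,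
      not_false_eq_true, zero_pow, zero_mul, sub_zero, sub_eq_zero] at h
    rw [eq_div_iff (pow_ne_zero _ hσ0), pow_succ σ, Nat.factorial_succ]
    calc _ = σ ^ (n + 1) * (σ * ∫ u in Ioi (0 : ℝ), (u : ℂ) ^ (n + 1) * Complex.exp (-(u * σ))) := by
          ring
      _ = _ := by
          rw [← h]
          push_cast
          field_simp

/-! ### Holomorphy and remainders of Laplace integrals -/

/-- A parametric integral, locally dominated, of functions holomorphic in the parameter is
holomorphic. -/
theorem differentiableOn_integral_of_locally_dominated {X : Type*} [MeasurableSpace X]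
    {μ : Measure X} {U : Set ℂ} (hU : IsOpen U) {h : ℂ → X → ℂ}
    (hmeas : ∀ w ∈ U, AEStronglyMeasurable (h w) μ)
    (hdiff : ∀ᵐ u ∂μ, DifferentiableOn ℂ (fun w => h w u) U)
    (hdom : ∀ w₀ ∈ U, ∃ V ∈ 𝓝 w₀, ∃ bound : X → ℝ, Integrable bound μ ∧
      ∀ᵐ u ∂μ, ∀ w ∈ V, ‖h w u‖ ≤ bound u) :
    DifferentiableOn ℂ (fun w => ∫ u, h w u ∂μ) U := by
  intro w₀ hw₀
  obtain ⟨V, hV, bound, hbound, hle⟩ := hdom w₀ hw₀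
  obtain ⟨R, hR, hRV⟩ := Metric.nhds_basis_closedBall.mem_iff.1
    (inter_mem hV (hU.mem_nhds hw₀))
  have hR2 : 0 < R / 2 := half_pos hR
  have hsub : ∀ w ∈ Metric.ball w₀ (R / 2), Metric.closedBall w (R / 2) ⊆ V ∩ U := by
    intro w hw
    refine Subset.trans (Metric.closedBall_subset_closedBall' ?_) hRV
    have := Metric.mem_ball.1 hw
    linarith
  have hball : Metric.ball w₀ (R / 2) ∈ 𝓝 w₀ := Metric.ball_mem_nhds _ hR2
  have hU' : ∀ w ∈ Metric.ball w₀ (R / 2), w ∈ U := fun w hw =>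
    (hsub w hw (Metric.mem_closedBall_self hR2.le)).2
  have hderiv : ∀ᵐ u ∂μ, ∀ w ∈ Metric.ball w₀ (R / 2),
      HasDerivAt (fun w => h w u) (deriv (fun w => h w u) w) w := by
    filter_upwards [hdiff] with u hu w hw
    exact (hu.differentiableAt (hU.mem_nhds (hU' w hw))).hasDerivAt
  refine DifferentiableAt.differentiableWithinAt ?_
  refine (hasDerivAt_integral_of_dominated_loc_of_deriv_le (F := h)
    (F' := fun w u => deriv (fun w => h w u) w) (bound := fun u => bound u / (R / 2))
    hball ?_ ?_ ?_ ?_ (hbound.div_const _) hderiv).2.differentiableAt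
  · filter_upwards [hball] with w hw using hmeas w (hU' w hw)
  · refine hbound.mono' (hmeas w₀ hw₀) ?_
    filter_upwards [hle] with u hu using hu _ (mem_of_mem_nhds hV)
  -- The derivative is measurable in `u` as a limit of slopes along a sequence tending to `w₀`.
  · let x : ℕ → ℂ := fun n => w₀ + ((R / 4 * (1 / ((n : ℝ) + 1)) : ℝ) : ℂ)
    have hx0 : ∀ n : ℕ, 0 < R / 4 * (1 / ((n : ℝ) + 1)) := fun n => by positivity
    have hxU : ∀ n, x n ∈ U := by
      intro n
      refine hU' _ ?_
      rw [Metric.mem_ball, dist_eq_norm, add_sub_cancel_left, Complex.norm_real,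
        Real.norm_eq_abs, abs_of_pos (hx0 n)]
      have : 1 / ((n : ℝ) + 1) ≤ 1 := by
        rw [div_le_one (by positivity)]
        have : (0 : ℝ) ≤ n := n.cast_nonneg
        linarith
      nlinarith
    have hxlim : Tendsto x atTop (𝓝[≠] w₀) := by
      refine tendsto_nhdsWithin_iff.2 ⟨?_, Eventually.of_forall fun n => ?_⟩
      · have h1 := (tendsto_one_div_add_atTop_nhds_zero_nat (𝕜 := ℝ)).const_mul (R / 4)
        have h2 := (Complex.continuous_ofReal.tendsto _).comp h1
        simpa [x, Function.comp_def] using h2.const_add w₀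
      · simp only [mem_compl_iff, mem_singleton_iff, x, add_eq_left, Complex.ofReal_eq_zero]
        exact (hx0 n).ne'
    refine aestronglyMeasurable_of_tendsto_ae atTop
      (f := fun n u => slope (fun w => h w u) w₀ (x n)) (fun n => ?_) ?_
    · simp only [slope_def_field]
      exact (((hmeas _ (hxU n)).sub (hmeas _ hw₀)).mul_const (x n - w₀)⁻¹).congr
        (.of_forall fun u => (div_eq_mul_inv _ _).symm)
    · filter_upwards [hderiv] with u hu
      exact (hasDerivAt_iff_tendsto_slope.1 (hu w₀ (Metric.mem_ball_self hR2))).comp hxlim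
  · filter_upwards [hle, hdiff] with u hu hu' w hw
    -- Cauchy's estimate on circles of radius `R / 2` inside `V` dominates the derivative.
    refine Complex.norm_deriv_le_of_forall_mem_sphere_norm_le hR2 ?_ fun y hy =>
      hu _ (hsub w hw (Metric.sphere_subset_closedBall hy)).1
    refine (hu'.mono ?_).diffContOnCl
    rw [closure_ball _ hR2.ne']
    exact (hsub w hw).trans inter_subset_right

/-- The kernel decays at rate at least `κ‖σ‖`; since `‖z‖ ≤ κ / 2`, the growth of `g` uses up at
most half of it. -/
theorem norm_laplace_integrand_le {g z σ : ℂ} {M κ u : ℝ} (hσ : κ * ‖σ‖ ≤ σ.re)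
    (hz : ‖z‖ ≤ κ / 2) (hu : 0 < u) (hg : ‖g‖ ≤ M * Real.exp ‖(u : ℂ) * (z * σ)‖) :
    ‖g * (Complex.exp (-(u * σ)) * σ)‖ ≤ M * ‖σ‖ * Real.exp (-(κ / 2 * ‖σ‖ * u)) := by
  have hM : 0 ≤ M := nonneg_of_mul_nonneg_left ((norm_nonneg _).trans hg) (Real.exp_pos _)
  have hn : ‖(u : ℂ)‖ = u := by rw [Complex.norm_real, Real.norm_eq_abs, abs_of_pos hu]
  simp only [norm_mul, hn, Complex.norm_exp, Complex.neg_re, Complex.re_ofReal_mul] at hg ⊢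
  calc ‖g‖ * (Real.exp (-(u * σ.re)) * ‖σ‖)
      ≤ M * Real.exp (u * (‖z‖ * ‖σ‖)) * (Real.exp (-(u * σ.re)) * ‖σ‖) := by gcongr
    _ = M * ‖σ‖ * Real.exp (u * (‖z‖ * ‖σ‖) + -(u * σ.re)) := by
        rw [Real.exp_add]
        ring
    _ ≤ _ := by
        gcongr
        have h2 : ‖z‖ * ‖σ‖ ≤ κ / 2 * ‖σ‖ := by gcongr
        nlinarith

/-- The remainders of the formal Laplace transform: if `B_N = b_N + t B_{N+1}` along the ray
`t = u z σ`, and `B_N` grows like `A^N e^{|t|}`, then the Laplace integral of `B_0` is, up to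
Gevrey errors, the sum of `b_p p! z^p`. -/
theorem norm_laplace_sub_sum_le {B : ℕ → ℂ → ℂ} {b : ℕ → ℂ} {z σ : ℂ} {K A κ : ℝ}
    (hκ : 0 < κ) (hσ0 : σ ≠ 0) (hσ : κ * ‖σ‖ ≤ σ.re) (hz : ‖z‖ ≤ κ / 2)
    (hmeas : ∀ N, Measurable (B N))
    (hrec : ∀ N, ∀ u : ℝ, 0 < u → B N (u * (z * σ)) = b N + u * (z * σ) * B (N + 1) (u * (z * σ)))
    (hle : ∀ N, ∀ u : ℝ, 0 < u →
      ‖B N (u * (z * σ))‖ ≤ K * A ^ N * Real.exp ‖(u : ℂ) * (z * σ)‖) (N : ℕ) :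
    ‖(∫ u in Ioi (0 : ℝ), B 0 (u * (z * σ)) * (Complex.exp (-(u * σ)) * σ)) -
      ∑ p ∈ Finset.range N, b p * p ! * z ^ p‖ ≤ 2 * K / κ * (2 * A / κ) ^ N * N ! * ‖z‖ ^ N := by
  have hσn : 0 < ‖σ‖ := norm_pos_iff.2 hσ0
  have hσre : 0 < σ.re := (mul_pos hκ hσn).trans_le hσ
  have hκσ : 0 < κ / 2 * ‖σ‖ := by positivity
  -- The remainder integrand `t^N B_N(t) e^{-uσ} σ` at `t = u z σ`, followed by its majorant.
  let I : ℕ → ℝ → ℂ := fun N u =>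
    (u * (z * σ)) ^ N * B N (u * (z * σ)) * (Complex.exp (-(u * σ)) * σ)
  let D : ℕ → ℝ → ℝ := fun N u => K * A ^ N * ‖z‖ ^ N * ‖σ‖ ^ (N + 1) *
    (u ^ N * Real.exp (-(κ / 2 * ‖σ‖ * u)))
  have hI : ∀ N, ∀ u : ℝ, 0 < u → ‖I N u‖ ≤ D N u := by
    intro N u hu
    have hn : ‖(u : ℂ)‖ = u := by rw [Complex.norm_real, Real.norm_eq_abs, abs_of_pos hu]
    calc ‖I N u‖ = (u * (‖z‖ * ‖σ‖)) ^ N *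
          ‖B N (u * (z * σ)) * (Complex.exp (-(u * σ)) * σ)‖ := by
          simp only [I, norm_mul, norm_pow, hn]
          ring
      _ ≤ (u * (‖z‖ * ‖σ‖)) ^ N *
          (K * A ^ N * ‖σ‖ * Real.exp (-(κ / 2 * ‖σ‖ * u))) := by
          gcongr
          exact norm_laplace_integrand_le hσ hz hu (hle N u hu)
      _ = D N u := by
          simp only [D]
          ring
  have hDint : ∀ N, IntegrableOn (D N) (Ioi 0) := fun N =>
    (integrableOn_pow_mul_exp_neg_mul hκσ N).const_mul _
  have hIle : ∀ N, ∀ᵐ u ∂volume.restrict (Ioi (0 : ℝ)), ‖I N u‖ ≤ D N u := fun N => by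
    filter_upwards [ae_restrict_mem measurableSet_Ioi] with u hu using hI N u hu
  have hImeas : ∀ N, Measurable (I N) := fun N => by
    have := hmeas N
    fun_prop
  have hIint : ∀ N, IntegrableOn (I N) (Ioi 0) := fun N =>
    (hDint N).mono' (hImeas N).aestronglyMeasurable (hIle N)
  have hstep : ∀ N, ∫ u in Ioi (0 : ℝ), I N u =
      b N * N ! * z ^ N + ∫ u in Ioi (0 : ℝ), I (N + 1) u := by
    intro N
    have e1 : ∫ u in Ioi (0 : ℝ), I N u = ∫ u in Ioi (0 : ℝ),
        (b N * (z * σ) ^ N * σ * ((u : ℂ) ^ N * Complex.exp (-(u * σ))) + I (N + 1) u) := by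
      refine setIntegral_congr_fun measurableSet_Ioi fun u hu => ?_
      simp only [I]
      rw [hrec N u hu]
      ring
    rw [e1, integral_add ((integrableOn_pow_mul_cexp_neg_mul hσre N).const_mul _) (hIint _),
      integral_const_mul, integral_pow_mul_cexp_neg_mul hσre]
    congr 1
    field_simp
    ring
  have hsum : ∀ N, (∫ u in Ioi (0 : ℝ), B 0 (u * (z * σ)) * (Complex.exp (-(u * σ)) * σ)) -
      ∑ p ∈ Finset.range N, b p * p ! * z ^ p = ∫ u in Ioi (0 : ℝ), I N u := by
    intro N
    induction N with
    | zero => simp [I]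
    | succ N ih =>
      rw [Finset.sum_range_succ, ← sub_sub, ih, hstep]
      ring
  rw [hsum]
  refine (norm_integral_le_of_norm_le (hDint N) (hIle N)).trans_eq ?_
  rw [integral_const_mul, integral_pow_mul_exp_neg_mul hκσ]
  simp only [mul_pow, div_pow]
  field_simp
  ring

/-! ### Sectors and the rotated ray of integration -/

theorem isOpen_boundedSector (d α ρ : ℝ) : IsOpen (boundedSector d α ρ) := by
  unfold boundedSector LogSurface.argument LogSurface.modulus
  refine IsOpen.and (isOpen_lt ?_ continuous_const) (isOpen_lt ?_ continuous_const)
  · exact (Complex.continuous_im.sub continuous_const).abs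
  · exact Real.continuous_exp.comp Complex.continuous_re

theorem convex_boundedSector (d α : ℝ) {ρ : ℝ} (hρ : 0 < ρ) : Convex ℝ (boundedSector d α ρ) := by
  have : boundedSector d α ρ =
      Complex.imLm ⁻¹' Metric.ball d (Real.pi * α / 2) ∩ Complex.reLm ⁻¹' Iio (Real.log ρ) := by
    ext w
    simp [boundedSector, LogSurface.argument, LogSurface.modulus, Real.dist_eq,
      Real.lt_log_iff_exp_lt hρ]
  rw [this]
  exact ((convex_ball _ _).linear_preimage _).inter ((convex_Iio _).linear_preimage _)

theorem isSectorialRegion_boundedSector (d : ℝ) {α ρ : ℝ} (hα : 0 < α) (hρ : 0 < ρ) :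
    IsSectorialRegion d α (boundedSector d α ρ) where
  isOpen := isOpen_boundedSector d α ρ
  isConnected := by
    refine ⟨⟨⟨Real.log (ρ / 2), d⟩, ?_, ?_⟩, (convex_boundedSector d α hρ).isPreconnected⟩
    · simp only [LogSurface.argument, sub_self, abs_zero]
      positivity
    · simp only [LogSurface.modulus]
      rw [Real.exp_log (half_pos hρ)]
      exact half_lt_self hρ
  subset_sector := fun _ hw => hw.1
  sector_subset := fun β _ hβ => ⟨ρ, hρ, fun w hw => ⟨hw.1.trans_le (by gcongr), hw.2⟩⟩

/-- The rotation of the ray of integration: `z⁻¹` in direction `d`, up to a small power of `z`. -/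
noncomputable def laplaceRotation (c d : ℝ) (w : ℂ) : ℂ :=
  Complex.exp (-(c * (w - d * Complex.I)))

theorem cos_mul_norm_laplaceRotation_le {c d δ : ℝ} {w : ℂ} (hδ : δ ≤ Real.pi)
    (hw : |c * (w.im - d)| ≤ δ) :
    Real.cos δ * ‖laplaceRotation c d w‖ ≤ (laplaceRotation c d w).re := by
  rw [laplaceRotation, Complex.norm_exp, Complex.exp_re, mul_comm]
  have h : (-(c * (w - d * Complex.I)) : ℂ).im = -(c * (w.im - d)) := by simp
  rw [h, Real.cos_neg, ← Real.cos_abs (c * _)]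
  gcongr
  exact Real.cos_le_cos_of_nonneg_of_le_pi (abs_nonneg _) hδ hw

theorem exp_mul_laplaceRotation (c d : ℝ) (w : ℂ) :
    Complex.exp w * laplaceRotation c d w = Real.exp ((1 - c) * w.re) *
      Complex.exp ((d + (1 - c) * (w.im - d) : ℝ) * Complex.I) := by
  rw [laplaceRotation, ← Complex.exp_add, Complex.ofReal_exp, ← Complex.exp_add]
  congr 1
  apply Complex.ext <;> simp
  all_goals ring

theorem differentiableAt_recSum {a b : ℕ → ℂ} {r : ℕ} {t : ℂ} (ht : charDenom a r t ≠ 0) :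
    DifferentiableAt ℂ (recSum a r b) t := by
  have : DifferentiableAt ℂ (charDenom a r) t := by
    unfold charDenom
    fun_prop
  unfold recSum
  exact DifferentiableAt.div (by fun_prop) this ht

theorem measurable_recSum (a b : ℕ → ℂ) (r : ℕ) : Measurable (recSum a r b) := by
  unfold recSum charDenom
  fun_prop

theorem isOfGevreyOrder_one {F : PowerSeries ℂ} {C A : ℝ} (hC : 0 < C) (hA : 0 < A)
    (h : ∀ p, ‖PowerSeries.coeff p F / (p ! : ℂ)‖ ≤ C * A ^ p) : IsOfGevreyOrder 1 F := by
  refine ⟨C, A, hC, hA, fun p => ?_⟩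
  have := h p
  rwa [norm_div, Complex.norm_natCast, div_le_iff₀ (by positivity), ← Real.rpow_one (p ! : ℝ)]
    at this

/-- The Laplace integral of a function that is holomorphic and of exponential growth on a thin
sector is holomorphic on a bounded sector of opening larger than `π`. -/
theorem differentiableOn_laplace {c d K κ : ℝ} {U : Set ℂ} {B : ℂ → ℂ} (hU : IsOpen U)
    (hK : 0 ≤ K) (hκ : 0 < κ) (hmeas : Measurable B)
    (hσ : ∀ w ∈ U, κ * ‖laplaceRotation c d w‖ ≤ (laplaceRotation c d w).re)
    (hz : ∀ w ∈ U, ‖Complex.exp w‖ ≤ κ / 2)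
    (hdiff : ∀ w ∈ U, ∀ u : ℝ, 0 < u →
      DifferentiableAt ℂ B (u * (Complex.exp w * laplaceRotation c d w)))
    (hle : ∀ w ∈ U, ∀ u : ℝ, 0 < u → ‖B (u * (Complex.exp w * laplaceRotation c d w))‖ ≤
      K * Real.exp ‖(u : ℂ) * (Complex.exp w * laplaceRotation c d w)‖) :
    DifferentiableOn ℂ (fun w => ∫ u in Ioi (0 : ℝ),
      B (u * (Complex.exp w * laplaceRotation c d w)) *
        (Complex.exp (-(u * laplaceRotation c d w)) * laplaceRotation c d w)) U := by
  have hrot : Differentiable ℂ (laplaceRotation c d) := by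
    unfold laplaceRotation
    fun_prop
  refine differentiableOn_integral_of_locally_dominated hU (fun w _ => ?_) ?_ fun w₀ hw₀ => ?_
  · exact Measurable.aestronglyMeasurable (by fun_prop)
  · filter_upwards [ae_restrict_mem measurableSet_Ioi] with u hu w hw
    refine DifferentiableAt.differentiableWithinAt (DifferentiableAt.mul ?_ (by fun_prop))
    exact (hdiff w hw u hu).comp w
      (f := fun w => (u : ℂ) * (Complex.exp w * laplaceRotation c d w)) (by fun_prop)
  · have hpos : 0 < ‖laplaceRotation c d w₀‖ := norm_pos_iff.2 (Complex.exp_ne_zero _)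
    set m := ‖laplaceRotation c d w₀‖
    have hcont : ContinuousAt (fun w => ‖laplaceRotation c d w‖) w₀ :=
      hrot.continuous.norm.continuousAt
    -- Pinching `‖σ‖` between `m / 2` and `2 * m` lets one majorant serve all nearby `w`.
    have hV : ∀ᶠ w in 𝓝 w₀, w ∈ U ∧ m / 2 < ‖laplaceRotation c d w‖ ∧
        ‖laplaceRotation c d w‖ < 2 * m :=
      (hU.eventually_mem hw₀).and ((hcont.eventually_const_lt (half_lt_self hpos)).and
        (hcont.eventually_lt_const (by linarith)))
    have hint := (integrableOn_pow_mul_exp_neg_mul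
      (show 0 < κ / 2 * (m / 2) by positivity) 0).const_mul (K * (2 * m))
    refine ⟨_, hV, _, hint, ?_⟩
    filter_upwards [ae_restrict_mem measurableSet_Ioi] with u hu w hw
    obtain ⟨hwU, h1, h2⟩ := hw
    have hu' : (0 : ℝ) < u := hu
    refine (norm_laplace_integrand_le (hσ w hwU) (hz w hwU) hu' (hle w hwU u hu')).trans ?_
    rw [pow_zero, one_mul]
    gcongr

/-! ### Summability from the recurrence -/

theorem isSummableInDirection_one_of_recurrence (F : PowerSeries ℂ) (r : ℕ) (a : ℕ → ℂ)
    (hF : ∀ j : ℕ, r < j → PowerSeries.coeff j F / (j ! : ℂ) =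
      ∑ k ∈ Finset.Icc 1 r, a k * (PowerSeries.coeff (j - k) F / ((j - k)! : ℂ)))
    (d : ℝ)
    (hd : ∀ ζ : ℂ, (1 - ∑ k ∈ Finset.Icc 1 r,
        Polynomial.C (a k) * Polynomial.X ^ k : ℂ[X]).IsRoot ζ →
      (Complex.arg ζ : Real.Angle) ≠ (d : Real.Angle)) :
    IsSummableInDirection 1 F d := by
  set b : ℕ → ℂ := fun p => PowerSeries.coeff p F / (p ! : ℂ) with hbdef
  have hb : ∀ j, r < j → b j = ∑ k ∈ Finset.range r, a (k + 1) * b (j - (k + 1)) := by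
    intro j hj
    rw [← sum_Icc_one_eq_sum_range r fun k => a k * b (j - k)]
    exact hF j hj
  obtain ⟨C, A, hC, hA, hbound⟩ := exists_norm_le_geometric hb
  have hA0 : 0 < A := one_pos.trans_le hA
  obtain ⟨ε, q, hε, hq, hden⟩ := exists_sector_le_norm_eval _
    (by rw [eval_charPoly]; simp [charDenom]) d hd
  simp only [eval_charPoly] at hden
  obtain ⟨K, hK, hrec⟩ := exists_norm_recSum_shift_le (a := a) (r := r) hC hA hbound hq
  -- The half-opening `π(1+η)/2` is at most `4`, so `arg t` deviates from `d` by at most `4η ≤ ε`.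
  set η : ℝ := min (1 / 2) (ε / 4)
  have hη : 0 < η := by positivity
  have hη2 : η ≤ 1 / 2 := min_le_left _ _
  have hηε : η ≤ ε / 4 := min_le_right _ _
  have hπ := Real.pi_pos
  have hπ4 := Real.pi_le_four
  -- `δ = (1 - η²)π/2 < π/2` bounds `|arg σ|` on the sector.
  set δ : ℝ := (1 - η) * (Real.pi * (1 + η) / 2) with hδ
  have hδ2 : δ < Real.pi / 2 := by
    have : 0 < Real.pi * (η * η) := by positivity
    rw [hδ]
    linarith
  have hδ0 : 0 ≤ δ := by
    have : 0 ≤ 1 - η := by linarith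
    positivity
  set κ := Real.cos δ
  have hκ : 0 < κ := Real.cos_pos_of_mem_Ioo ⟨by linarith, hδ2⟩
  set U := boundedSector d (1 + η) (κ / 2)
  set σ : ℂ → ℂ := laplaceRotation (1 - η) d
  have hσ : ∀ w ∈ U, κ * ‖σ w‖ ≤ (σ w).re := by
    intro w hw
    refine cos_mul_norm_laplaceRotation_le (by linarith) ?_
    rw [abs_mul, abs_of_nonneg (by linarith)]
    exact mul_le_mul_of_nonneg_left hw.1.le (by linarith)
  have hz : ∀ w ∈ U, ‖Complex.exp w‖ ≤ κ / 2 := fun w hw => by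
    rw [Complex.norm_exp]
    exact hw.2.le
  have hQ : ∀ w ∈ U, ∀ u : ℝ, 0 < u →
      q ≤ ‖charDenom a r (u * (Complex.exp w * σ w))‖ := by
    intro w hw u hu
    rw [exp_mul_laplaceRotation, ← mul_assoc, ← Complex.ofReal_mul]
    refine hden _ _ (by positivity) ?_
    have h1 : |w.im - d| ≤ Real.pi * (1 + η) / 2 := hw.1.le
    have h2 : Real.pi * (1 + η) / 2 ≤ 4 := by nlinarith
    rw [add_sub_cancel_left, sub_sub_cancel, abs_mul, abs_of_pos hη]
    nlinarith
  have hQ0 : ∀ w ∈ U, ∀ u : ℝ, 0 < u → charDenom a r (u * (Complex.exp w * σ w)) ≠ 0 :=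
    fun w hw u hu => norm_pos_iff.1 (hq.trans_le (hQ w hw u hu))
  let B : ℕ → ℂ → ℂ := fun N => recSum a r fun p => b (N + p)
  have hB : ∀ w ∈ U, ∀ N, ∀ u : ℝ, 0 < u → ‖B N (u * (Complex.exp w * σ w))‖ ≤
      K * A ^ N * Real.exp ‖(u : ℂ) * (Complex.exp w * σ w)‖ :=
    fun w hw N u hu => hrec N _ (hQ w hw u hu)
  rw [IsSummableInDirection, div_one]
  refine ⟨isOfGevreyOrder_one hC hA0 hbound, 1 + η, by linarith, U,
    isSectorialRegion_boundedSector d (by linarith) (half_pos hκ),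
    fun w => ∫ u in Ioi (0 : ℝ), B 0 (u * (Complex.exp w * σ w)) *
      (Complex.exp (-(u * σ w)) * σ w), ?_, fun T hT => ?_⟩
  · refine differentiableOn_laplace (isOpen_boundedSector _ _ _) hK.le hκ
      (measurable_recSum _ _ _) hσ hz
      (fun w hw u hu => differentiableAt_recSum (hQ0 w hw u hu)) fun w hw u hu => ?_
    have := hB w hw 0 u hu
    rwa [pow_zero, mul_one] at this
  · refine ⟨2 * K / κ, 2 * A / κ, by positivity, by positivity, fun N w hwT => ?_⟩
    have hw : w ∈ U := hT.2 (subset_closure hwT)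
    have h := norm_laplace_sub_sum_le (B := B) (b := b) (σ := σ w) hκ (Complex.exp_ne_zero _) (hσ w hw)
      (hz w hw) (fun N => measurable_recSum _ _ _) (fun N u hu => ?_) (hB w hw) N
    · rw [Complex.norm_exp, ← Real.rpow_one (N ! : ℝ)] at h
      have hcoeff : ∀ p, b p * (p ! : ℂ) = PowerSeries.coeff p F := fun p =>
        div_mul_cancel₀ _ (by exact_mod_cast p.factorial_ne_zero)
      simp only [hcoeff] at h
      exact h
    · have h := recSum_eq_add_mul (b := fun p => b (N + p)) (r := r) (a := a) ?_ (hQ0 w hw u hu)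
      · simpa only [B, add_zero, Nat.add_right_comm N 1, Nat.add_assoc] using h
      -- The shifted sequence needs the recurrence only at `N + r + 1`, an index that exceeds `r`
      -- for every `N`.
      · rw [hb (N + (r + 1)) (by omega)]
        refine Finset.sum_congr rfl fun k hk => ?_
        rw [Nat.add_sub_assoc (by have := Finset.mem_range.1 hk; omega)]

end GevreySummability

theorem mainTheorem3 (F : PowerSeries ℂ) (hF : PowerSeries.constantCoeff F = 0)
    (r : ℕ) (a : ℕ → ℂ) :
    ((∀ j : ℕ, r < j → PowerSeries.coeff j F =
        ∑ k ∈ Finset.Icc 1 r, a k * (j.descFactorial k : ℂ) * PowerSeries.coeff (j - k) F) ↔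
      (∀ j : ℕ, r < j → PowerSeries.coeff j F / (j ! : ℂ) =
        ∑ k ∈ Finset.Icc 1 r, a k * (PowerSeries.coeff (j - k) F / ((j - k)! : ℂ)))) ∧
    ((∀ j : ℕ, r < j → PowerSeries.coeff j F =
        ∑ k ∈ Finset.Icc 1 r, a k * (j.descFactorial k : ℂ) * PowerSeries.coeff (j - k) F) →
      ∀ d : ℝ,
        (∀ ζ : ℂ, (1 - ∑ k ∈ Finset.Icc 1 r,
            Polynomial.C (a k) * Polynomial.X ^ k : ℂ[X]).IsRoot ζ →
          (Complex.arg ζ : Real.Angle) ≠ (d : Real.Angle)) →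
        GevreySummability.IsSummableInDirection 1 F d) := by
  have hiff := forall₂_congr fun j hj => GevreySummability.recurrence_iff_borel
    (fun p => PowerSeries.coeff p F) a r j hj
  exact ⟨hiff, fun h d hd =>
    GevreySummability.isSummableInDirection_one_of_recurrence F r a (hiff.1 h) d hd⟩
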